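/- Let $k$ be a field of characteristic zero, $n\ge 0$, and $q_{ij}\in k$ for $i=1,2$ and $1\le j\le n$. A \emph{planar $n$-tree} is a finite rooted tree with edges coloured by $\{1,\dots,n\}$ in which, at each vertex, the incoming (upward) edges of each colour are linearly ordered. Let $A=A_n$ be the free unital associative $k$-algebra on the planar $n$-trees; the ordered forests (words of trees) $u$ form a basis of $A$, and $A$ is graded by the number $|u|$ of vertices. Let $\lambda:A^{\otimes n}\to A$ be the linear map that sends an $n$-tuple of ordered forests $(f_1,\dots,f_n)$ to the tree obtained by joining the roots of $f_i$, in their order, to a new root by edges of colour $i$. Let $\sigma_i:A^{\otimes n}\to A$ be given on forests by $\sigma_i(f_1,\dots,f_n)=q_{i1}^{|f_1|}\cdots q_{in}^{|f_n|}\,f_1\cdots f_n$. Let $\Delta:A\to A\otimes A$ be the algebra homomorphism determined by $\Delta\circ\lambda=(\sigma_1\otimes\lambda+\lambda\otimes\sigma_2)\circ\tau\circ\Delta^{\otimes n}$, where $\tau:(A\otimes A)^{\otimes n}\to A^{\otimes n}\otimes A^{\otimes n}$ separates the tensor factors. With the counit $\varepsilon$ that vanishes on all trees, $(A,\Delta,\varepsilon)$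 is a bialgebra. For a set $s$ of vertices of an ordered forest $u$, with complement $s^c$, and $v\in s$, let $p_j(v,s,u)$ be the number of edges of colour $j$ on the path in $u$ from $v$ to the root of its component whose lower vertex is in $s^c$. Put $$q(s,u)=\prod_{j=1}^n\Bigl(\prod_{v\in s}q_{1j}^{\,p_j(v,s,u)}\prod_{v\in s^c}q_{2j}^{\,p_j(v,s^c,u)}\Bigr).$$ A set $s$ of vertices is itself regarded as an ordered forest, with the induced partial order: an edge of $s$ from $v$ up to $w$ has the colour of the first edge of the path in $u$ from $v$ up to $w$, and the trees of $s$, and the edges of the same colour at a vertex of $s$, are ordered as they occur in $u$ from left to right, where edges of different colours at a vertex of $u$ are compared by their colours, $1<2<\dots<n$. 1. For every ordered forest $u$ (in particular for every planar $n$-tree), $$\Delta(u)=\sum_{s\subset u}q(s,u)\;s\otimes s^c,$$ the sum being over all sets $s$ of vertices of $u$, and $s$, $s^c$ denoting the (non-commutative) products in $A$ of the trees of the respective ordered forests. 2. Let $A^*$ be the graded dual of $A$, with the product $(\varphi\psi)(x)=(\varphi\otimes\psi)(\Delta x)$ and the coproduct that is transpose to the multiplication of $A$. For a planar $n$-tree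 $t$ let $D_t\in A^*$ be the element dual to $t$ with respect to the basis of ordered forests. The vector space $P(A^*)$ of primitive elements of $A^*$ has the elements $D_t$ as a basis. For all planar $n$-trees $s,t$ there are only finitely many planar $n$-trees $w$ for which the coefficient in the following sum is non-zero, and there is a bilinear (not necessarily associative) product $\bullet$ on $P(A^*)$ with $$D_s\bullet D_t=\sum_{w}\Bigl(\sum_{S\subset w,\ S\cong s,\ S^c\cong t}q(S,w)\Bigr)D_w ,$$ where $w$ runs over all planar $n$-trees and $S$ over the sets of vertices of $w$ for which $S$ and $S^c$, as ordered forests, are the single trees $s$ and $t$. Moreover $P(A^*)$ is closed under the commutator of the product of $A^*$, and its Lie bracket is the commutator of $\bullet$: $[\varphi,\psi]=\varphi\psi-\psi\varphi=\varphi\bullet\psi-\psi\bullet\varphi$ for all $\varphi,\psi\in P(A^*)$. -/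

import Mathlib

open scoped TensorProduct
open Module

/-- Planar rooted trees whose edges are coloured by `Fin n`, the incoming edges of each colour at
each vertex being linearly ordered: `node f` is the tree with a root to which, for every colour
`i`, the roots of the ordered list of trees `f i` are attached by edges of colour `i`. -/
inductive PlanarTree (n : ℕ) : Type
  | node (f : Fin n → List (PlanarTree n)) : PlanarTree n

namespace PlanarTree

section Trees

variable {n : ℕ}

/-! ### Vertices

A vertex of a tree is recorded by the path that leads to it from the root: the list of the edges
of this path, starting at the root, where an edge is given by its colour and by its position among
the edges of that colour at its lower vertex. The root is `[]`, and `v` lies below `w` if and only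
if `v` is a prefix of `w`. A vertex of an ordered forest is a pair consisting of the position of
a tree of the forest and a vertex of that tree. -/

mutual
/-- The set of vertices of a tree. -/
def vertices : PlanarTree n → Finset (List (Fin n × ℕ))
  | node f => insert [] (Finset.univ.biUnion fun i =>
      (forestVertices (f i)).image fun v => (i, v.1) :: v.2)
/-- The set of vertices of an ordered forest. -/
def forestVertices : List (PlanarTree n) → Finset (ℕ × List (Fin n × ℕ))
  | [] => ∅
  | t :: u => (vertices t).image (fun v => (0, v)) ∪
      (forestVertices u).image (fun v => (v.1 + 1, v.2))
end

mutual
/-- The number of vertices of a tree. -/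
def size : PlanarTree n → ℕ
  | node f => 1 + ∑ i, forestSize (f i)
/-- The number of vertices of an ordered forest. -/
def forestSize : List (PlanarTree n) → ℕ
  | [] => 0
  | t :: u => size t + forestSize u
end

mutual
theorem card_vertices : ∀ t : PlanarTree n, (vertices t).card = size t
  | node f => by
    rw [vertices, size, Finset.card_insert_of_notMem (by simp), Finset.card_biUnion, add_comm]
    · congr 1
      refine Finset.sum_congr rfl fun i _ => ?_
      rw [Finset.card_image_of_injective, card_forestVertices (f i)]
      intro v w h
      simp only [List.cons.injEq, Prod.mk.injEq, true_and] at h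
      exact Prod.ext h.1 h.2
    · intro i _ j _ hij
      simp only [Function.onFun, Finset.disjoint_left, Finset.mem_image, not_exists, not_and]
      rintro a ⟨v, _, rfl⟩ w _ h
      simp only [List.cons.injEq, Prod.mk.injEq] at h
      exact hij h.1.1.symm
/-- `size` and `forestSize` do count the vertices. -/
theorem card_forestVertices : ∀ u : List (PlanarTree n),
    (forestVertices u).card = forestSize u
  | [] => by simp [forestVertices, forestSize]
  | t :: u => by
    rw [forestVertices, forestSize, Finset.card_union_of_disjoint,
      Finset.card_image_of_injective, Finset.card_image_of_injective, card_vertices t,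
      card_forestVertices u]
    · intro v w h
      simp only [Prod.mk.injEq, add_left_inj] at h
      exact Prod.ext h.1 h.2
    · intro v w h
      exact (Prod.mk.inj h).2
    · simp only [Finset.disjoint_left, Finset.mem_image, not_exists, not_and]
      rintro a ⟨v, _, rfl⟩ w _ h
      simp at h
end

/-! ### Subforests -/

open Classical in
mutual
/-- The ordered forest formed by a set `s` of vertices of a tree, with the induced partial order.
If `s` contains the root, this is a single tree with that root, and an edge of it that joins
a vertex `w` to a vertex `v` below it carries the colour of the first edge of the path
from `v` up to `w`. If `s` does not contain the root, the forests which `s` cuts out of the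
branches are listed one after the other, in the order of the colours and, for edges
of the same colour, in their given order. -/
noncomputable def treeInduced :
    PlanarTree n → Set (List (Fin n × ℕ)) → List (PlanarTree n)
  | node f, s =>
    if [] ∈ s then [node fun i => induced (f i) {v | (i, v.1) :: v.2 ∈ s}]
    else (List.ofFn fun i => induced (f i) {v | (i, v.1) :: v.2 ∈ s}).flatten
/-- The ordered forest formed by a set `s` of vertices of an ordered forest. -/
noncomputable def induced :
    List (PlanarTree n) → Set (ℕ × List (Fin n × ℕ)) → List (PlanarTree n)
  | [], _ => []
  | t :: u, s => treeInduced t {v | (0, v) ∈ s} ++ induced u {v | (v.1 + 1, v.2) ∈ s}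
end

/-- `p_j(v, s, u)`: the number of edges of colour `j` on the path from the root
(of the component of `v`) to `v` whose lower vertex is not in `s`. -/
def pathCount (j : Fin n) (v : ℕ × List (Fin n × ℕ)) (s : Finset (ℕ × List (Fin n × ℕ))) : ℕ :=
  (Finset.univ.filter fun i : Fin v.2.length =>
    (v.2.get i).1 = j ∧ (v.1, v.2.take i) ∉ s).card

/-- The weight `q(s, u)` of a set `s` of vertices of the ordered forest `u`. -/
def weight {k : Type*} [Field k] (q₁ q₂ : Fin n → k) (u : List (PlanarTree n))
    (s : Finset (ℕ × List (Fin n × ℕ))) : k :=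
  ∏ j, ((∏ v ∈ s, q₁ j ^ pathCount j v s) *
    ∏ v ∈ forestVertices u \ s, q₂ j ^ pathCount j v (forestVertices u \ s))

open Classical in
/-- The sum of the weights `q(S, w)` over all sets `S` of vertices of the tree `w` such that `S`
is isomorphic to the tree `s` and its complement is isomorphic to the tree `t`. -/
noncomputable def insertionCoeff {k : Type*} [Field k] (q₁ q₂ : Fin n → k)
    (s t w : PlanarTree n) : k :=
  ∑ S ∈ (forestVertices [w]).powerset.filter fun S : Finset (ℕ × List (Fin n × ℕ)) =>
      induced [w] (S : Set _) = [s] ∧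
        induced [w] ((forestVertices [w] \ S : Finset (ℕ × List (Fin n × ℕ))) : Set _) = [t],
    weight q₁ q₂ [w] S

end Trees

section Algebra

variable {k : Type*} [Field k] {n : ℕ}

/-- An ordered forest, as an element of the free algebra on the planar trees: the product of its
trees. -/
noncomputable def mono (u : List (PlanarTree n)) : FreeAlgebra k (PlanarTree n) :=
  (u.map (FreeAlgebra.ι k)).prod

/-- The basis of the free algebra that consists of the ordered forests. -/
noncomputable abbrev forestBasis (k : Type*) [Field k] (n : ℕ) :
    Basis (FreeMonoid (PlanarTree n)) k (FreeAlgebra k (PlanarTree n)) :=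
  FreeAlgebra.basisFreeMonoid k (PlanarTree n)

theorem forestBasis_apply (u : FreeMonoid (PlanarTree n)) :
    forestBasis k n u = mono u.toList := by
  simp [forestBasis, FreeAlgebra.basisFreeMonoid, mono,
    FreeAlgebra.equivMonoidAlgebraFreeMonoid, FreeMonoid.lift_apply]

/-- The `n`-ary operation `λ`, which joins forests `f₁, …, fₙ` to a new root, the roots of `fᵢ`
by edges of colour `i`. -/
noncomputable def lam : (⨂[k] _ : Fin n, FreeAlgebra k (PlanarTree n)) →ₗ[k]
    FreeAlgebra k (PlanarTree n) :=
  (Basis.piTensorProduct fun _ : Fin n => forestBasis k n).constr k fun u =>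
    FreeAlgebra.ι k (node fun i => (u i).toList)

theorem lam_mono (f : Fin n → List (PlanarTree n)) :
    lam (PiTensorProduct.tprod k fun i => mono (k := k) (f i)) = FreeAlgebra.ι k (node f) := by
  have h := (Basis.piTensorProduct fun _ : Fin n => forestBasis k n).constr_basis k
    (fun u => FreeAlgebra.ι k (node fun i => (u i).toList)) (fun i => FreeMonoid.ofList (f i))
  rw [Basis.piTensorProduct_apply] at h
  simpa [forestBasis_apply, lam] using h

/-- The isomorphism that separates the tensor factors of `(M ⊗ N)^{⊗ n}`; see
`shuffle_tprod`. -/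
noncomputable def shuffle {M N κ κ' : Type*} [AddCommGroup M] [Module k M] [AddCommGroup N]
    [Module k N] (b : Basis κ k M) (b' : Basis κ' k N) :
    (⨂[k] _ : Fin n, M ⊗[k] N) →ₗ[k] (⨂[k] _ : Fin n, M) ⊗[k] (⨂[k] _ : Fin n, N) :=
  (Basis.piTensorProduct fun _ : Fin n => b.tensorProduct b').constr k fun p =>
    (PiTensorProduct.tprod k fun i => b (p i).1) ⊗ₜ (PiTensorProduct.tprod k fun i => b' (p i).2)

theorem shuffle_tprod {M N κ κ' : Type*} [AddCommGroup M] [Module k M] [AddCommGroup N]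
    [Module k N] (b : Basis κ k M) (b' : Basis κ' k N) (x : Fin n → M) (y : Fin n → N) :
    shuffle b b' (PiTensorProduct.tprod k fun i => x i ⊗ₜ y i) =
      PiTensorProduct.tprod k x ⊗ₜ PiTensorProduct.tprod k y := by
  have h1 : ∀ v : Fin n → κ, ∀ w : Fin n → κ',
      shuffle b b' (PiTensorProduct.tprod k fun i => b (v i) ⊗ₜ b' (w i)) =
      PiTensorProduct.tprod k (fun i => b (v i)) ⊗ₜ PiTensorProduct.tprod k fun i => b' (w i) := by
    intro v w
    have h := (Basis.piTensorProduct fun _ : Fin n => b.tensorProduct b').constr_basis k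
      (fun p => (PiTensorProduct.tprod k fun i => b (p i).1) ⊗ₜ[k]
        (PiTensorProduct.tprod k fun i => b' (p i).2)) (fun i => (v i, w i))
    rw [Basis.piTensorProduct_apply] at h
    simpa [Basis.tensorProduct_apply, shuffle] using h
  have h2 : ∀ v : Fin n → κ, ∀ y : Fin n → N,
      shuffle b b' (PiTensorProduct.tprod k fun i => b (v i) ⊗ₜ y i) =
      PiTensorProduct.tprod k (fun i => b (v i)) ⊗ₜ PiTensorProduct.tprod k y := by
    intro v y
    have := Basis.ext_multilinear
      (f := (shuffle b b' ∘ₗ LinearMap.id).compMultilinearMap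
        ((PiTensorProduct.tprod k).compLinearMap fun i => TensorProduct.mk k M N (b (v i))))
      (g := (TensorProduct.mk k _ _
        (PiTensorProduct.tprod k fun i => b (v i))).compMultilinearMap (PiTensorProduct.tprod k))
      (fun _ => b') (fun w => by simpa using h1 v w)
    simpa using congrArg (fun F => F y) this
  have := Basis.ext_multilinear
      (f := (shuffle b b' ∘ₗ LinearMap.id).compMultilinearMap
        ((PiTensorProduct.tprod k).compLinearMap fun i => (TensorProduct.mk k M N).flip (y i)))
      (g := ((TensorProduct.mk k _ _).flip
        (PiTensorProduct.tprod k y)).compMultilinearMap (PiTensorProduct.tprod k))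
      (fun _ => b) (fun v => by simpa using h2 v y)
  exact congrArg (fun F => F x) this

/-- The algebra map that multiplies an ordered forest `u` by `c ^ |u|`. -/
noncomputable def scale (c : k) :
    FreeAlgebra k (PlanarTree n) →ₐ[k] FreeAlgebra k (PlanarTree n) :=
  FreeAlgebra.lift k fun t => c ^ t.size • FreeAlgebra.ι k t

/-- The map `σ(u₁, …, uₙ) = q₁^|u₁| ⋯ qₙ^|uₙ| u₁ ⋯ uₙ`. -/
noncomputable def sigma (q : Fin n → k) : (⨂[k] _ : Fin n, FreeAlgebra k (PlanarTree n)) →ₗ[k]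
    FreeAlgebra k (PlanarTree n) :=
  PiTensorProduct.lift
    ((MultilinearMap.mkPiAlgebraFin k n (FreeAlgebra k (PlanarTree n))).compLinearMap
      fun i => (scale (q i)).toLinearMap)

/-- The `n`-ary operation `(σ₁ ⊗ λ + λ ⊗ σ₂) ∘ τ` on the tensor square of the free algebra, where
`τ` separates the tensor factors. -/
noncomputable def pairOp (q₁ q₂ : Fin n → k) :
    (⨂[k] _ : Fin n, FreeAlgebra k (PlanarTree n) ⊗[k] FreeAlgebra k (PlanarTree n)) →ₗ[k]
      FreeAlgebra k (PlanarTree n) ⊗[k] FreeAlgebra k (PlanarTree n) :=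
  (TensorProduct.map (sigma q₁) lam + TensorProduct.map lam (sigma q₂)) ∘ₗ
    shuffle (forestBasis k n) (forestBasis k n)

mutual
/-- The coproduct of a tree. -/
noncomputable def treeComul (q₁ q₂ : Fin n → k) :
    PlanarTree n → FreeAlgebra k (PlanarTree n) ⊗[k] FreeAlgebra k (PlanarTree n)
  | node f => pairOp q₁ q₂ (PiTensorProduct.tprod k fun i => forestComul q₁ q₂ (f i))
/-- The coproduct of an ordered forest. -/
noncomputable def forestComul (q₁ q₂ : Fin n → k) :
    List (PlanarTree n) → FreeAlgebra k (PlanarTree n) ⊗[k] FreeAlgebra k (PlanarTree n)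
  | [] => 1
  | t :: u => treeComul q₁ q₂ t * forestComul q₁ q₂ u
end

/-- The coproduct: the algebra map `Δ` with `Δ ∘ λ = (σ₁ ⊗ λ + λ ⊗ σ₂) ∘ τ ∘ Δ^{⊗ n}`;
see `comulHom_lam`. -/
noncomputable def comulHom (q₁ q₂ : Fin n → k) : FreeAlgebra k (PlanarTree n) →ₐ[k]
    FreeAlgebra k (PlanarTree n) ⊗[k] FreeAlgebra k (PlanarTree n) :=
  FreeAlgebra.lift k (treeComul q₁ q₂)

/-- The counit: the algebra map that vanishes on all trees. -/
noncomputable def counitHom : FreeAlgebra k (PlanarTree n) →ₐ[k] k :=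
  FreeAlgebra.lift k fun _ => 0

theorem sigma_tprod (q : Fin n → k) (x : Fin n → FreeAlgebra k (PlanarTree n)) :
    sigma q (PiTensorProduct.tprod k x) = (List.ofFn fun i => scale (q i) (x i)).prod := by
  simp [sigma]

theorem comulHom_mono (q₁ q₂ : Fin n → k) :
    ∀ u : List (PlanarTree n), comulHom q₁ q₂ (mono u) = forestComul q₁ q₂ u
  | [] => by simp [mono, forestComul]
  | t :: u => by
    have := comulHom_mono q₁ q₂ u
    simp only [mono, List.map_cons, List.prod_cons, map_mul, forestComul] at this ⊢
    rw [this]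
    simp [comulHom]

theorem comulHom_ι (q₁ q₂ : Fin n → k) (f : Fin n → List (PlanarTree n)) :
    comulHom q₁ q₂ (FreeAlgebra.ι k (node f)) =
      pairOp q₁ q₂ (PiTensorProduct.tprod k fun i => comulHom q₁ q₂ (mono (f i))) := by
  simp only [comulHom_mono]
  simp [comulHom, treeComul]

/-- Multilinear maps on the free algebra agree if they do so on ordered forests. -/
theorem ext_mono {N : Type*} [AddCommGroup N] [Module k N]
    {F G : MultilinearMap k (fun _ : Fin n => FreeAlgebra k (PlanarTree n)) N}
    (h : ∀ f : Fin n → List (PlanarTree n), F (fun i => mono (f i)) = G fun i => mono (f i)) :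
    F = G :=
  Basis.ext_multilinear (fun _ => forestBasis k n) fun v => by
    simpa [forestBasis_apply] using h fun i => (v i).toList

/-- Multilinear maps on the tensor square agree if they do so on pure tensors. -/
theorem ext_tmul {M N L κ κ' : Type*} [AddCommGroup M] [Module k M] [AddCommGroup N]
    [Module k N] [AddCommGroup L] [Module k L] (b : Basis κ k M) (b' : Basis κ' k N)
    {F G : MultilinearMap k (fun _ : Fin n => M ⊗[k] N) L}
    (h : ∀ (x : Fin n → M) (y : Fin n → N), F (fun i => x i ⊗ₜ y i) = G fun i => x i ⊗ₜ y i) :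
    F = G :=
  Basis.ext_multilinear (fun _ => b.tensorProduct b') fun v => by
    have hb : ∀ i, b.tensorProduct b' (v i) = b (v i).1 ⊗ₜ b' (v i).2 := fun i =>
      Basis.tensorProduct_apply b b' (v i).1 (v i).2
    simpa only [hb] using h (fun i => b (v i).1) fun i => b' (v i).2

theorem comulHom_lam (q₁ q₂ : Fin n → k) (x : Fin n → FreeAlgebra k (PlanarTree n)) :
    comulHom q₁ q₂ (lam (PiTensorProduct.tprod k x)) =
      pairOp q₁ q₂ (PiTensorProduct.tprod k fun i => comulHom q₁ q₂ (x i)) := by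
  have := ext_mono
    (F := ((comulHom q₁ q₂).toLinearMap ∘ₗ lam).compMultilinearMap (PiTensorProduct.tprod k))
    (G := (pairOp q₁ q₂).compMultilinearMap
      ((PiTensorProduct.tprod k).compLinearMap fun _ => (comulHom q₁ q₂).toLinearMap))
    (fun f => by simp [lam_mono, comulHom_ι])
  exact congrArg (fun F => F x) this

theorem pairOp_tmul (q₁ q₂ : Fin n → k) (x y : Fin n → FreeAlgebra k (PlanarTree n)) :
    pairOp q₁ q₂ (PiTensorProduct.tprod k fun i => x i ⊗ₜ y i) =
      sigma q₁ (PiTensorProduct.tprod k x) ⊗ₜ lam (PiTensorProduct.tprod k y) +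
      lam (PiTensorProduct.tprod k x) ⊗ₜ sigma q₂ (PiTensorProduct.tprod k y) := by
  simp [pairOp, shuffle_tprod]

theorem scale_mono (c : k) : ∀ u : List (PlanarTree n),
    scale c (mono u) = c ^ forestSize u • mono u
  | [] => by simp [mono, forestSize]
  | t :: u => by
    have := scale_mono c u
    simp only [mono, List.map_cons, List.prod_cons, map_mul, forestSize] at this ⊢
    rw [this]
    simp [scale, pow_add, mul_smul, smul_comm (c ^ forestSize u)]

theorem scale_lam (c : k) (x : Fin n → FreeAlgebra k (PlanarTree n)) :
    scale c (lam (PiTensorProduct.tprod k x)) =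
      c • lam (PiTensorProduct.tprod k fun i => scale c (x i)) := by
  have := ext_mono (n := n)
    (F := ((scale c).toLinearMap ∘ₗ lam).compMultilinearMap (PiTensorProduct.tprod k))
    (G := (c • lam).compMultilinearMap
      ((PiTensorProduct.tprod k).compLinearMap fun _ => (scale c).toLinearMap))
    (fun f => by
      simp only [LinearMap.compMultilinearMap_apply, LinearMap.comp_apply, AlgHom.toLinearMap_apply,
        LinearMap.smul_apply, MultilinearMap.compLinearMap_apply, scale_mono, lam_mono,
        MultilinearMap.map_smul_univ, map_smul]
      simp [scale, size, pow_add, Finset.prod_pow_eq_pow_sum, mul_smul,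
        smul_comm c (c ^ ∑ i, forestSize (f i))])
  exact congrArg (fun F => F x) this

theorem scale_comm (c d : k) (x : FreeAlgebra k (PlanarTree n)) :
    scale c (scale d x) = scale d (scale c x) := by
  have : (scale (n := n) c).comp (scale d) = (scale d).comp (scale c) := by
    ext t
    simp [scale, smul_comm (c ^ t.size)]
  exact congrArg (fun F => F x) this

theorem scale_sigma (c : k) (q : Fin n → k) (x : Fin n → FreeAlgebra k (PlanarTree n)) :
    scale c (sigma q (PiTensorProduct.tprod k x)) =
      sigma q (PiTensorProduct.tprod k fun i => scale c (x i)) := by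
  simp only [sigma_tprod, map_list_prod, List.map_ofFn]
  congr 2
  funext i
  exact scale_comm _ _ _

theorem scale_pairOp (c : k) (q₁ q₂ : Fin n → k)
    (x : Fin n → FreeAlgebra k (PlanarTree n) ⊗[k] FreeAlgebra k (PlanarTree n)) :
    Algebra.TensorProduct.map (scale c) (scale c) (pairOp q₁ q₂ (PiTensorProduct.tprod k x)) =
      c • pairOp q₁ q₂ (PiTensorProduct.tprod k fun i =>
        Algebra.TensorProduct.map (scale c) (scale c) (x i)) := by
  have := ext_tmul (forestBasis k n) (forestBasis k n)
    (F := ((Algebra.TensorProduct.map (scale c) (scale c)).toLinearMap ∘ₗ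
      pairOp q₁ q₂).compMultilinearMap (PiTensorProduct.tprod k))
    (G := (c • pairOp q₁ q₂).compMultilinearMap ((PiTensorProduct.tprod k).compLinearMap
      fun _ => (Algebra.TensorProduct.map (scale c) (scale c)).toLinearMap))
    (fun x y => by
      simp [pairOp_tmul, scale_sigma, scale_lam, TensorProduct.tmul_smul,
        TensorProduct.smul_tmul', smul_add])
  exact congrArg (fun F => F x) this

/-- An induction principle for trees. -/
theorem tree_induction {P : PlanarTree n → Prop}
    (h : ∀ f, (∀ i, ∀ t ∈ f i, P t) → P (node f)) (t : PlanarTree n) : P t :=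
  PlanarTree.rec (motive_1 := P) (motive_2 := fun u => ∀ t ∈ u, P t)
    h (by simp) (fun t u ht hu => by simpa using ⟨ht, hu⟩) t

/-- Two algebra maps agree if, for every tree, they agree on it when they agree on its branches. -/
theorem algHom_ext_tree {B : Type*} [Semiring B] [Algebra k B]
    {F G : FreeAlgebra k (PlanarTree n) →ₐ[k] B}
    (h : ∀ f : Fin n → List (PlanarTree n), (∀ i, F (mono (f i)) = G (mono (f i))) →
      F (FreeAlgebra.ι k (node f)) = G (FreeAlgebra.ι k (node f))) : F = G := by
  ext t
  induction t using tree_induction with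
  | h f ih =>
    refine h f fun i => ?_
    simp only [mono, map_list_prod, List.map_map]
    congr 1
    exact List.map_congr_left fun t ht => ih i t ht

theorem comulHom_scale (c : k) (q₁ q₂ : Fin n → k) (x : FreeAlgebra k (PlanarTree n)) :
    comulHom q₁ q₂ (scale c x) =
      Algebra.TensorProduct.map (scale c) (scale c) (comulHom q₁ q₂ x) := by
  have : (comulHom q₁ q₂).comp (scale c) =
      (Algebra.TensorProduct.map (scale c) (scale c)).comp (comulHom q₁ q₂) := by
    refine algHom_ext_tree fun f ih => ?_
    simp only [AlgHom.comp_apply] at ih ⊢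
    rw [← lam_mono, scale_lam, map_smul, comulHom_lam, comulHom_lam, scale_pairOp]
    simp only [ih]
  exact congrArg (fun F => F x) this

theorem prod_tmul : ∀ {m : ℕ} (x y : Fin m → FreeAlgebra k (PlanarTree n)),
    (List.ofFn fun i => x i ⊗ₜ[k] y i).prod = (List.ofFn x).prod ⊗ₜ (List.ofFn y).prod
  | 0, _, _ => by simp [Algebra.TensorProduct.one_def]
  | m + 1, x, y => by simp [List.ofFn_succ, prod_tmul]

/-- The operations `σ` are compatible with the coproduct. -/
theorem comulHom_sigma (q₁ q₂ q : Fin n → k) (x : Fin n → FreeAlgebra k (PlanarTree n)) :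
    comulHom q₁ q₂ (sigma q (PiTensorProduct.tprod k x)) =
      TensorProduct.map (sigma q) (sigma q) (shuffle (forestBasis k n) (forestBasis k n)
        (PiTensorProduct.tprod k fun i => comulHom q₁ q₂ (x i))) := by
  have := ext_tmul (forestBasis k n) (forestBasis k n)
    (F := (MultilinearMap.mkPiAlgebraFin k n _).compLinearMap fun i =>
      (Algebra.TensorProduct.map (scale (q i)) (scale (q i))).toLinearMap)
    (G := ((TensorProduct.map (sigma q) (sigma q)) ∘ₗ shuffle (forestBasis k n)
      (forestBasis k n)).compMultilinearMap (PiTensorProduct.tprod k))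
    (fun x y => by simp [shuffle_tprod, sigma_tprod, prod_tmul])
  have := congrArg (fun F => F fun i => comulHom q₁ q₂ (x i)) this
  simp only [MultilinearMap.compLinearMap_apply, MultilinearMap.mkPiAlgebraFin_apply,
    AlgHom.toLinearMap_apply, LinearMap.compMultilinearMap_apply, LinearMap.comp_apply] at this
  rw [← this, sigma_tprod, map_list_prod, List.map_ofFn]
  simp [Function.comp_def, comulHom_scale]

theorem counitHom_lam (x : ⨂[k] _ : Fin n, FreeAlgebra k (PlanarTree n)) :
    counitHom (lam x) = 0 := by
  have : counitHom.toLinearMap ∘ₗ lam (k := k) (n := n) = 0 :=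
    (Basis.piTensorProduct fun _ : Fin n => forestBasis k n).ext fun u => by
      simp [lam, counitHom, -Basis.piTensorProduct_apply]
  exact congrArg (fun F => F x) this

theorem counitHom_scale (c : k) (x : FreeAlgebra k (PlanarTree n)) :
    counitHom (scale c x) = counitHom x := by
  have : counitHom.comp (scale (n := n) c) = counitHom := by
    ext t
    simp [scale, counitHom]
  exact congrArg (fun F => F x) this

theorem counitHom_sigma (q : Fin n → k) (x : Fin n → FreeAlgebra k (PlanarTree n)) :
    counitHom (sigma q (PiTensorProduct.tprod k x)) = ∏ i, counitHom (x i) := by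
  rw [sigma_tprod, map_list_prod, List.map_ofFn, List.prod_ofFn]
  simp [counitHom_scale]

theorem rTensor_pairOp (q₁ q₂ : Fin n → k)
    (x : Fin n → FreeAlgebra k (PlanarTree n) ⊗[k] FreeAlgebra k (PlanarTree n)) :
    Algebra.TensorProduct.lid k _ (Algebra.TensorProduct.map counitHom (.id k _)
      (pairOp q₁ q₂ (PiTensorProduct.tprod k x))) =
    lam (PiTensorProduct.tprod k fun i => Algebra.TensorProduct.lid k _
      (Algebra.TensorProduct.map counitHom (.id k _) (x i))) := by
  have := ext_tmul (forestBasis k n) (forestBasis k n)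
    (F := ((Algebra.TensorProduct.lid k (FreeAlgebra k (PlanarTree n))).toLinearMap ∘ₗ
      (Algebra.TensorProduct.map counitHom (.id k _)).toLinearMap ∘ₗ
      pairOp q₁ q₂).compMultilinearMap (PiTensorProduct.tprod k))
    (G := lam.compMultilinearMap ((PiTensorProduct.tprod k).compLinearMap fun _ =>
      (Algebra.TensorProduct.lid k (FreeAlgebra k (PlanarTree n))).toLinearMap ∘ₗ
      (Algebra.TensorProduct.map counitHom (.id k _)).toLinearMap))
    (fun x y => by
      simp [pairOp_tmul, counitHom_sigma, counitHom_lam, MultilinearMap.map_smul_univ])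
  exact congrArg (fun F => F x) this

theorem lTensor_pairOp (q₁ q₂ : Fin n → k)
    (x : Fin n → FreeAlgebra k (PlanarTree n) ⊗[k] FreeAlgebra k (PlanarTree n)) :
    Algebra.TensorProduct.rid k k _ (Algebra.TensorProduct.map (.id k _) counitHom
      (pairOp q₁ q₂ (PiTensorProduct.tprod k x))) =
    lam (PiTensorProduct.tprod k fun i => Algebra.TensorProduct.rid k k _
      (Algebra.TensorProduct.map (.id k _) counitHom (x i))) := by
  have := ext_tmul (forestBasis k n) (forestBasis k n)
    (F := ((Algebra.TensorProduct.rid k k (FreeAlgebra k (PlanarTree n))).toLinearMap ∘ₗ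
      (Algebra.TensorProduct.map (.id k _) counitHom).toLinearMap ∘ₗ
      pairOp q₁ q₂).compMultilinearMap (PiTensorProduct.tprod k))
    (G := lam.compMultilinearMap ((PiTensorProduct.tprod k).compLinearMap fun _ =>
      (Algebra.TensorProduct.rid k k (FreeAlgebra k (PlanarTree n))).toLinearMap ∘ₗ
      (Algebra.TensorProduct.map (.id k _) counitHom).toLinearMap))
    (fun x y => by
      simp [pairOp_tmul, counitHom_sigma, counitHom_lam, MultilinearMap.map_smul_univ])
  exact congrArg (fun F => F x) this

/-- The three-fold analogue of `pairOp`. -/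
noncomputable def tripleOp (q₁ q₂ : Fin n → k) :
    (⨂[k] _ : Fin n, FreeAlgebra k (PlanarTree n) ⊗[k]
      (FreeAlgebra k (PlanarTree n) ⊗[k] FreeAlgebra k (PlanarTree n))) →ₗ[k]
    FreeAlgebra k (PlanarTree n) ⊗[k]
      (FreeAlgebra k (PlanarTree n) ⊗[k] FreeAlgebra k (PlanarTree n)) :=
  (TensorProduct.map (sigma q₁) (TensorProduct.map (sigma q₁) lam + TensorProduct.map lam (sigma q₂))
      + TensorProduct.map lam (TensorProduct.map (sigma q₂) (sigma q₂))) ∘ₗ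
    (shuffle (forestBasis k n) (forestBasis k n)).lTensor _ ∘ₗ
    shuffle (forestBasis k n) ((forestBasis k n).tensorProduct (forestBasis k n))

theorem comul_right_pairOp (q₁ q₂ : Fin n → k)
    (x : Fin n → FreeAlgebra k (PlanarTree n) ⊗[k] FreeAlgebra k (PlanarTree n)) :
    Algebra.TensorProduct.map (.id k _) (comulHom q₁ q₂)
      (pairOp q₁ q₂ (PiTensorProduct.tprod k x)) =
    tripleOp q₁ q₂ (PiTensorProduct.tprod k fun i =>
      Algebra.TensorProduct.map (.id k _) (comulHom q₁ q₂) (x i)) := by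
  have := ext_tmul (forestBasis k n) (forestBasis k n)
    (F := ((Algebra.TensorProduct.map (.id k _) (comulHom q₁ q₂)).toLinearMap ∘ₗ
      pairOp q₁ q₂).compMultilinearMap (PiTensorProduct.tprod k))
    (G := (tripleOp q₁ q₂).compMultilinearMap ((PiTensorProduct.tprod k).compLinearMap fun _ =>
      (Algebra.TensorProduct.map (.id k _) (comulHom q₁ q₂)).toLinearMap))
    (fun x y => by
      simp [tripleOp, shuffle_tprod, comulHom_lam, comulHom_sigma, pairOp])
  exact congrArg (fun F => F x) this

theorem comul_left_pairOp (q₁ q₂ : Fin n → k)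
    (x : Fin n → FreeAlgebra k (PlanarTree n) ⊗[k] FreeAlgebra k (PlanarTree n)) :
    Algebra.TensorProduct.assoc k k k _ _ _ (Algebra.TensorProduct.map (comulHom q₁ q₂) (.id k _)
      (pairOp q₁ q₂ (PiTensorProduct.tprod k x))) =
    tripleOp q₁ q₂ (PiTensorProduct.tprod k fun i => Algebra.TensorProduct.assoc k k k _ _ _
      (Algebra.TensorProduct.map (comulHom q₁ q₂) (.id k _) (x i))) := by
  have key : ∀ (z : Fin n → FreeAlgebra k (PlanarTree n) ⊗[k] FreeAlgebra k (PlanarTree n))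
      (y : Fin n → FreeAlgebra k (PlanarTree n)),
      tripleOp q₁ q₂ (PiTensorProduct.tprod k fun i =>
        TensorProduct.assoc k _ _ _ (z i ⊗ₜ y i)) =
      TensorProduct.assoc k _ _ _
        (TensorProduct.map (sigma q₁) (sigma q₁) (shuffle (forestBasis k n) (forestBasis k n)
          (PiTensorProduct.tprod k z)) ⊗ₜ lam (PiTensorProduct.tprod k y)) +
      TensorProduct.assoc k _ _ _
        (pairOp q₁ q₂ (PiTensorProduct.tprod k z) ⊗ₜ sigma q₂ (PiTensorProduct.tprod k y)) := by
    intro z y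
    have := ext_tmul (forestBasis k n) (forestBasis k n)
      (F := (tripleOp q₁ q₂).compMultilinearMap ((PiTensorProduct.tprod k).compLinearMap fun i =>
        (TensorProduct.assoc k (FreeAlgebra k (PlanarTree n)) (FreeAlgebra k (PlanarTree n))
          (FreeAlgebra k (PlanarTree n))).toLinearMap ∘ₗ (TensorProduct.mk k _ _).flip (y i)))
      (G := (((TensorProduct.assoc k (FreeAlgebra k (PlanarTree n)) (FreeAlgebra k (PlanarTree n))
          (FreeAlgebra k (PlanarTree n))).toLinearMap ∘ₗ
          (TensorProduct.mk k _ _).flip (lam (PiTensorProduct.tprod k y)) ∘ₗ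
          TensorProduct.map (sigma q₁) (sigma q₁) ∘ₗ
          shuffle (forestBasis k n) (forestBasis k n)) +
        ((TensorProduct.assoc k (FreeAlgebra k (PlanarTree n)) (FreeAlgebra k (PlanarTree n))
          (FreeAlgebra k (PlanarTree n))).toLinearMap ∘ₗ
          (TensorProduct.mk k _ _).flip (sigma q₂ (PiTensorProduct.tprod k y)) ∘ₗ
          pairOp q₁ q₂)).compMultilinearMap (PiTensorProduct.tprod k))
      (fun x x' => by
        simp [pairOp_tmul, tripleOp, shuffle_tprod,
          TensorProduct.tmul_add, add_assoc])
    simpa using congrArg (fun F => F z) this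
  have := ext_tmul (forestBasis k n) (forestBasis k n)
    (F := ((Algebra.TensorProduct.assoc k k k (FreeAlgebra k (PlanarTree n))
        (FreeAlgebra k (PlanarTree n)) (FreeAlgebra k (PlanarTree n))).toLinearMap ∘ₗ
      (Algebra.TensorProduct.map (comulHom q₁ q₂) (.id k _)).toLinearMap ∘ₗ
      pairOp q₁ q₂).compMultilinearMap (PiTensorProduct.tprod k))
    (G := (tripleOp q₁ q₂).compMultilinearMap ((PiTensorProduct.tprod k).compLinearMap fun _ =>
      (Algebra.TensorProduct.assoc k k k (FreeAlgebra k (PlanarTree n))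
        (FreeAlgebra k (PlanarTree n)) (FreeAlgebra k (PlanarTree n))).toLinearMap ∘ₗ
      (Algebra.TensorProduct.map (comulHom q₁ q₂) (.id k _)).toLinearMap))
    (fun x y => by
      have := key (fun i => comulHom q₁ q₂ (x i)) y
      simp only [LinearMap.compMultilinearMap_apply, LinearMap.comp_apply,
        MultilinearMap.compLinearMap_apply, AlgHom.toLinearMap_apply, AlgEquiv.toLinearMap_apply,
        Algebra.TensorProduct.map_tmul, pairOp_tmul, map_add, comulHom_lam, comulHom_sigma]
      exact this.symm)
  exact congrArg (fun F => F x) this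

/-- The bialgebra structure on the free algebra on the planar trees. -/
noncomputable abbrev bialgebra (q₁ q₂ : Fin n → k) : Bialgebra k (FreeAlgebra k (PlanarTree n)) :=
  Bialgebra.ofAlgHom (comulHom q₁ q₂) counitHom
    (algHom_ext_tree fun f ih => by
      have h1 := comul_left_pairOp q₁ q₂ fun i => comulHom q₁ q₂ (mono (f i))
      have h2 := comul_right_pairOp q₁ q₂ fun i => comulHom q₁ q₂ (mono (f i))
      simp only [← comulHom_ι] at h1 h2
      refine h1.trans (Eq.trans ?_ h2.symm)
      exact congrArg (fun z => tripleOp q₁ q₂ (PiTensorProduct.tprod k z)) (funext ih))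
    (by
      refine algHom_ext_tree fun f ih => ?_
      apply (Algebra.TensorProduct.lid k (FreeAlgebra k (PlanarTree n))).injective
      have h1 := rTensor_pairOp q₁ q₂ fun i => comulHom q₁ q₂ (mono (f i))
      simp only [← comulHom_ι] at h1
      refine h1.trans ?_
      have : (fun i => Algebra.TensorProduct.lid k _ (Algebra.TensorProduct.map counitHom
          (.id k _) (comulHom q₁ q₂ (mono (f i))))) = fun i => mono (k := k) (f i) := by
        funext i
        rw [← AlgEquiv.eq_symm_apply]
        exact ih i
      rw [this, lam_mono]
      simp)
    (by
      refine algHom_ext_tree fun f ih => ?_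
      apply (Algebra.TensorProduct.rid k k (FreeAlgebra k (PlanarTree n))).injective
      have h1 := lTensor_pairOp q₁ q₂ fun i => comulHom q₁ q₂ (mono (f i))
      simp only [← comulHom_ι] at h1
      refine h1.trans ?_
      have : (fun i => Algebra.TensorProduct.rid k k _ (Algebra.TensorProduct.map (.id k _)
          counitHom (comulHom q₁ q₂ (mono (f i))))) = fun i => mono (k := k) (f i) := by
        funext i
        rw [← AlgEquiv.eq_symm_apply]
        exact ih i
      rw [this, lam_mono]
      simp)

/-! ### The graded dual -/

/-- The graded dual of the free algebra `A` on the planar trees, which is graded by the number of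
vertices: the linear forms on `A` that vanish in all sufficiently large degrees. (The homogeneous
parts of `A` are finite-dimensional.) -/
noncomputable def gradedDual (k : Type*) [Field k] (n : ℕ) :
    Submodule k (Dual k (FreeAlgebra k (PlanarTree n))) where
  carrier := {φ | ∃ N, ∀ u : List (PlanarTree n), N ≤ forestSize u → φ (mono u) = 0}
  add_mem' := by
    rintro φ ψ ⟨N, hN⟩ ⟨M, hM⟩
    exact ⟨max N M, fun u hu => by
      simp [hN u (le_trans (le_max_left _ _) hu), hM u (le_trans (le_max_right _ _) hu)]⟩
  zero_mem' := ⟨0, fun _ _ => rfl⟩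
  smul_mem' := by
    rintro c φ ⟨N, hN⟩
    exact ⟨N, fun u hu => by simp [hN u hu]⟩

/-- The primitive elements of the graded dual. Its coproduct is the transpose of the
multiplication of `A` and its unit is the counit `ε` of `A`, so these are the `φ` whose image
under the transpose of the multiplication is `φ ⊗ ε + ε ⊗ φ`, as a linear form on `A ⊗ A`. -/
noncomputable def dualPrimitives (k : Type*) [Field k] (n : ℕ) :
    Submodule k (Dual k (FreeAlgebra k (PlanarTree n))) :=
  gradedDual k n ⊓ LinearMap.ker
    (LinearMap.lcomp k k (LinearMap.mul' k (FreeAlgebra k (PlanarTree n))) -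
      TensorProduct.dualDistrib k _ _ ∘ₗ
        ((TensorProduct.mk k _ _).flip (counitHom (n := n)).toLinearMap +
          TensorProduct.mk k _ _ (counitHom (n := n)).toLinearMap))

theorem mem_dualPrimitives {φ : Dual k (FreeAlgebra k (PlanarTree n))} :
    φ ∈ dualPrimitives k n ↔ φ ∈ gradedDual k n ∧
      φ ∘ₗ LinearMap.mul' k _ = TensorProduct.dualDistrib k _ _
        (φ ⊗ₜ counitHom.toLinearMap + counitHom.toLinearMap ⊗ₜ φ) := by
  rw [dualPrimitives, Submodule.mem_inf, LinearMap.mem_ker, LinearMap.sub_apply, sub_eq_zero]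
  rfl

/-- The element `D_t` dual to a planar tree `t`, with respect to the basis of ordered forests. -/
noncomputable def dualTree (k : Type*) [Field k] {n : ℕ} (t : PlanarTree n) :
    Dual k (FreeAlgebra k (PlanarTree n)) :=
  (forestBasis k n).coord (FreeMonoid.of t)

/-- The commutator with respect to the product of the dual, i.e. the convolution product
`φ * ψ = (φ ⊗ ψ) ∘ Δ`. -/
noncomputable def dualBracket (q₁ q₂ : Fin n → k) (φ ψ : Dual k (FreeAlgebra k (PlanarTree n))) :
    Dual k (FreeAlgebra k (PlanarTree n)) :=
  letI := bialgebra q₁ q₂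
  ⁅WithConv.toConv φ, WithConv.toConv ψ⁆.ofConv

end Algebra

end PlanarTree

-- The coproduct formula holds because both sides obey the same recursion. A set `s` of vertices of
-- `node f` amounts to sets `b i` of vertices of the forests `f i`, together with the choice whether
-- the root lies in `s`. The root in the complement gives the term `σ₁ ⊗ λ`, the root in `s` the
-- term `λ ⊗ σ₂`. If the root is not in `s`, the path of every vertex of `b i` gains one edge of
-- colour `i` that counts for the weight. This multiplies the weight by `q₁ i ^ (b i).card`, which
-- is the scalar in `σ₁`, since the forest formed by `b i` has `(b i).card` vertices; likewise for
-- `σ₂` and the complement. Over the trees of a forest, weights and induced forests are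
-- multiplicative (`treeComul_eq`, `forestComul_eq`).
--
-- For the dual, primitive means being a derivation along the counit, hence vanishing on all forests
-- that are not single trees (`mem_dualPrimitives_iff_mono`). As there are finitely many trees of
-- bounded size, such forms are finite combinations of the `D_t`. The product `•` is the convolution
-- product restricted to single trees, and its coefficients on the `D_t` are read off from the
-- coproduct formula. Convolution products of primitive elements fail the derivation rule only by `φ
-- x * ψ y + ψ x * φ y` (`dualMul_mul`). This is symmetric in `φ` and `ψ`, so the commutator is
-- primitive; it is therefore determined by its values on trees, where it is the commutator of `•`.

namespace PlanarTree

-- Sets of vertices: decomposition along the root and along the trees of a forest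

section Subsets

variable {n : ℕ}

/-- The set of vertices of a tree other than its root that consists of the sets `b i` of vertices
of the forests attached to the root by edges of colour `i`. -/
def graft (b : Fin n → Finset (ℕ × List (Fin n × ℕ))) : Finset (List (Fin n × ℕ)) :=
  Finset.univ.biUnion fun i => (b i).image fun v => (i, v.1) :: v.2

/-- The set of vertices of an ordered forest `t :: u` that consists of a set of vertices of `t` and
a set of vertices of `u`. -/
def juxtapose (a : Finset (List (Fin n × ℕ))) (b : Finset (ℕ × List (Fin n × ℕ))) :
    Finset (ℕ × List (Fin n × ℕ)) :=
  a.image (fun v => (0, v)) ∪ b.image (fun v => (v.1 + 1, v.2))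

@[simp] theorem nil_notMem_graft (b : Fin n → Finset (ℕ × List (Fin n × ℕ))) :
    [] ∉ graft b := by
  simp [graft]

@[simp] theorem cons_mem_graft {b : Fin n → Finset (ℕ × List (Fin n × ℕ))} {e : Fin n × ℕ}
    {v : List (Fin n × ℕ)} : e :: v ∈ graft b ↔ (e.2, v) ∈ b e.1 := by
  simp only [graft, Finset.mem_biUnion, Finset.mem_univ, true_and, Finset.mem_image,
    List.cons.injEq]
  constructor
  · rintro ⟨i, w, hw, rfl, rfl⟩
    exact hw
  · intro h
    exact ⟨e.1, _, h, rfl, rfl⟩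

@[simp] theorem zero_mem_juxtapose {a : Finset (List (Fin n × ℕ))}
    {b : Finset (ℕ × List (Fin n × ℕ))} {v : List (Fin n × ℕ)} :
    (0, v) ∈ juxtapose a b ↔ v ∈ a := by
  simp [juxtapose]

@[simp] theorem succ_mem_juxtapose {a : Finset (List (Fin n × ℕ))}
    {b : Finset (ℕ × List (Fin n × ℕ))} {m : ℕ} {v : List (Fin n × ℕ)} :
    (m + 1, v) ∈ juxtapose a b ↔ (m, v) ∈ b := by
  simp [juxtapose]

theorem vertices_node (f : Fin n → List (PlanarTree n)) :
    vertices (node f) = insert [] (graft fun i => forestVertices (f i)) := by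
  rw [vertices, graft]

theorem forestVertices_cons (t : PlanarTree n) (u : List (PlanarTree n)) :
    forestVertices (t :: u) = juxtapose (vertices t) (forestVertices u) := by
  rw [forestVertices, juxtapose]

theorem juxtapose_sdiff (a a' : Finset (List (Fin n × ℕ)))
    (b b' : Finset (ℕ × List (Fin n × ℕ))) :
    juxtapose a b \ juxtapose a' b' = juxtapose (a \ a') (b \ b') := by
  ext ⟨m, v⟩
  cases m <;> simp

theorem insert_graft_sdiff_graft (b c : Fin n → Finset (ℕ × List (Fin n × ℕ))) :
    insert [] (graft b) \ graft c = insert [] (graft fun i => b i \ c i) := by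
  ext v
  cases v <;> simp

theorem insert_graft_sdiff_insert_graft (b c : Fin n → Finset (ℕ × List (Fin n × ℕ))) :
    insert [] (graft b) \ insert [] (graft c) = graft fun i => b i \ c i := by
  ext v
  cases v <;> simp

theorem prod_graft {M : Type*} [CommMonoid M] (b : Fin n → Finset (ℕ × List (Fin n × ℕ)))
    (F : List (Fin n × ℕ) → M) :
    ∏ v ∈ graft b, F v = ∏ i, ∏ v ∈ b i, F ((i, v.1) :: v.2) := by
  rw [graft, Finset.prod_biUnion]
  · refine Finset.prod_congr rfl fun i _ => Finset.prod_image ?_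
    rintro ⟨m, v⟩ _ ⟨m', v'⟩ _ h
    simpa using h
  · intro i _ j _ hij
    simp only [Function.onFun, Finset.disjoint_left, Finset.mem_image, not_exists, not_and]
    rintro a ⟨v, _, rfl⟩ w _ h
    simp only [List.cons.injEq, Prod.mk.injEq] at h
    exact hij h.1.1.symm

theorem prod_juxtapose {M : Type*} [CommMonoid M] (a : Finset (List (Fin n × ℕ)))
    (b : Finset (ℕ × List (Fin n × ℕ))) (F : ℕ × List (Fin n × ℕ) → M) :
    ∏ v ∈ juxtapose a b, F v = (∏ v ∈ a, F (0, v)) * ∏ v ∈ b, F (v.1 + 1, v.2) := by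
  rw [juxtapose, Finset.prod_union, Finset.prod_image, Finset.prod_image]
  · rintro ⟨m, v⟩ _ ⟨m', v'⟩ _ h
    simpa using h
  · rintro v _ v' _ h
    simpa using h
  · simp only [Finset.disjoint_left, Finset.mem_image, not_exists, not_and]
    rintro a ⟨v, _, rfl⟩ w _ h
    simp at h

theorem card_graft (b : Fin n → Finset (ℕ × List (Fin n × ℕ))) :
    (graft b).card = ∑ i, (b i).card := by
  -- In `Multiplicative ℕ` a product of constants `ofAdd 1` records the cardinality.
  have := prod_graft b fun _ => Multiplicative.ofAdd 1
  simpa [← ofAdd_nsmul, ← ofAdd_sum] using this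

theorem card_juxtapose (a : Finset (List (Fin n × ℕ))) (b : Finset (ℕ × List (Fin n × ℕ))) :
    (juxtapose a b).card = a.card + b.card := by
  have := prod_juxtapose a b fun _ => Multiplicative.ofAdd 1
  simpa [← ofAdd_nsmul, ← ofAdd_add] using this

theorem exists_eq_graft {b : Fin n → Finset (ℕ × List (Fin n × ℕ))} {s : Finset (List (Fin n × ℕ))}
    (h : s ⊆ graft b) : ∃ c : Fin n → Finset (ℕ × List (Fin n × ℕ)),
      (∀ i, c i ⊆ b i) ∧ graft c = s := by
  refine ⟨fun i => (b i).filter fun v => (i, v.1) :: v.2 ∈ s,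
    fun i => Finset.filter_subset _ _, ?_⟩
  ext v
  cases v with
  | nil => simpa using fun h' => nil_notMem_graft b (h h')
  | cons e v => simpa using fun h' => cons_mem_graft.1 (h h')

theorem exists_eq_juxtapose {a : Finset (List (Fin n × ℕ))} {b s : Finset (ℕ × List (Fin n × ℕ))}
    (h : s ⊆ juxtapose a b) : ∃ a' ⊆ a, ∃ b' ⊆ b, juxtapose a' b' = s := by
  refine ⟨a.filter fun v => (0, v) ∈ s, Finset.filter_subset _ _,
    b.filter fun v => (v.1 + 1, v.2) ∈ s, Finset.filter_subset _ _, ?_⟩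
  ext ⟨m, v⟩
  cases m with
  | zero => simpa using fun h' => zero_mem_juxtapose.1 (h h')
  | succ m => simpa using fun h' => succ_mem_juxtapose.1 (h h')

theorem graft_injective : Function.Injective (graft (n := n)) := by
  intro b c h
  funext i
  ext ⟨m, v⟩
  have : (i, m) :: v ∈ graft b ↔ (i, m) :: v ∈ graft c := by rw [h]
  simpa using this

/-- The index set on the right is the one produced by expanding a multilinear map in a family of
sums. -/
theorem sum_powerset_graft {M : Type*} [AddCommMonoid M]
    (b : Fin n → Finset (ℕ × List (Fin n × ℕ))) (F : Finset (List (Fin n × ℕ)) → M) :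
    ∑ s ∈ (graft b).powerset, F s =
      ∑ c ∈ Fintype.piFinset fun i => (b i).powerset, F (graft c) := by
  symm
  refine Finset.sum_bij (fun c _ => graft c) ?_ (fun c _ c' _ h => graft_injective h) ?_
    fun _ _ => rfl
  · intro c hc
    simp only [Fintype.mem_piFinset, Finset.mem_powerset] at hc ⊢
    intro v hv
    cases v with
    | nil => simp at hv
    | cons e v => exact cons_mem_graft.2 (hc _ (cons_mem_graft.1 hv))
  · intro s hs
    obtain ⟨c, hc, rfl⟩ := exists_eq_graft (Finset.mem_powerset.1 hs)
    exact ⟨c, by simpa using hc, rfl⟩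

theorem sum_powerset_juxtapose {M : Type*} [AddCommMonoid M] (a : Finset (List (Fin n × ℕ)))
    (b : Finset (ℕ × List (Fin n × ℕ))) (F : Finset (ℕ × List (Fin n × ℕ)) → M) :
    ∑ s ∈ (juxtapose a b).powerset, F s =
      ∑ a' ∈ a.powerset, ∑ b' ∈ b.powerset, F (juxtapose a' b') := by
  rw [← Finset.sum_product']
  symm
  refine Finset.sum_bij (fun c _ => juxtapose c.1 c.2) ?_ ?_ ?_ fun _ _ => rfl
  · rintro ⟨a', b'⟩ h
    simp only [Finset.mem_product, Finset.mem_powerset] at h ⊢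
    rintro ⟨m, v⟩ hv
    cases m with
    | zero => exact zero_mem_juxtapose.2 (h.1 (zero_mem_juxtapose.1 hv))
    | succ m => exact succ_mem_juxtapose.2 (h.2 (succ_mem_juxtapose.1 hv))
  · rintro ⟨a', b'⟩ _ ⟨c', d'⟩ _ h
    simp only at h
    refine Prod.ext ?_ ?_
    · ext v
      simp only
      rw [← zero_mem_juxtapose (b := b'), h, zero_mem_juxtapose]
    · ext ⟨m, v⟩
      simp only
      rw [← succ_mem_juxtapose (a := a'), h, succ_mem_juxtapose]
  · intro s hs
    obtain ⟨a', ha, b', hb, rfl⟩ := exists_eq_juxtapose (Finset.mem_powerset.1 hs)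
    exact ⟨(a', b'), by simpa using ⟨ha, hb⟩, rfl⟩

/-! ### Induced forests -/

theorem treeInduced_graft (f : Fin n → List (PlanarTree n))
    (b : Fin n → Finset (ℕ × List (Fin n × ℕ))) :
    treeInduced (node f) (graft b : Set _) =
      (List.ofFn fun i => induced (f i) (b i : Set _)).flatten := by
  rw [treeInduced, if_neg (by simp)]
  simp

theorem treeInduced_insert_graft (f : Fin n → List (PlanarTree n))
    (b : Fin n → Finset (ℕ × List (Fin n × ℕ))) :
    treeInduced (node f) (insert [] (graft b) : Finset _) =
      [node fun i => induced (f i) (b i : Set _)] := by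
  rw [treeInduced, if_pos (by simp)]
  simp

theorem induced_juxtapose (t : PlanarTree n) (u : List (PlanarTree n))
    (a : Finset (List (Fin n × ℕ))) (b : Finset (ℕ × List (Fin n × ℕ))) :
    induced (t :: u) (juxtapose a b : Set _) =
      treeInduced t (a : Set _) ++ induced u (b : Set _) := by
  rw [induced]
  simp

theorem forestSize_append : ∀ u u' : List (PlanarTree n),
    forestSize (u ++ u') = forestSize u + forestSize u'
  | [], u' => by simp [forestSize]
  | t :: u, u' => by simp [forestSize, forestSize_append u u', add_assoc]

theorem forestSize_flatten : ∀ L : List (List (PlanarTree n)),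
    forestSize L.flatten = (L.map forestSize).sum
  | [] => by simp [forestSize]
  | u :: L => by simp [forestSize_append, forestSize_flatten L]

mutual
-- The inclusion matters: paths in `s` that are not vertices of `t` are ignored by `treeInduced` but
-- counted by `card`.
theorem forestSize_treeInduced : ∀ (t : PlanarTree n) (s : Finset (List (Fin n × ℕ))),
    s ⊆ vertices t → forestSize (treeInduced t (s : Set _)) = s.card
  | node f, s => fun h => by
    rw [vertices_node] at h
    have ih := fun i b => forestSize_induced (f i) b
    by_cases h0 : [] ∈ s
    · obtain ⟨b, hb, hs⟩ := exists_eq_graft (Finset.subset_insert_iff.1 h)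
      rw [← Finset.insert_erase h0, ← hs, treeInduced_insert_graft,
        Finset.card_insert_of_notMem (nil_notMem_graft b), card_graft]
      simp [forestSize, size, fun i => ih i (b i) (hb i), add_comm]
    · obtain ⟨b, hb, rfl⟩ := exists_eq_graft ((Finset.subset_insert_iff_of_notMem h0).1 h)
      rw [treeInduced_graft, card_graft, forestSize_flatten]
      simp [List.sum_ofFn, fun i => ih i (b i) (hb i)]
/-- The forest formed by a set of vertices has these vertices. -/
theorem forestSize_induced : ∀ (u : List (PlanarTree n)) (s : Finset (ℕ × List (Fin n × ℕ))),
    s ⊆ forestVertices u → forestSize (induced u (s : Set _)) = s.card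
  | [], s => fun h => by
    rw [forestVertices, Finset.subset_empty] at h
    simp [h, induced, forestSize]
  | t :: u, s => fun h => by
    rw [forestVertices_cons] at h
    obtain ⟨a, ha, b, hb, rfl⟩ := exists_eq_juxtapose h
    rw [induced_juxtapose, forestSize_append, card_juxtapose, forestSize_treeInduced t a ha,
      forestSize_induced u b hb]
end

/-! ### Weights -/

/-- The analogue of `pathCount` for a vertex of a tree. -/
def treePathCount (j : Fin n) (v : List (Fin n × ℕ)) (s : Finset (List (Fin n × ℕ))) : ℕ :=
  (Finset.univ.filter fun i : Fin v.length => (v.get i).1 = j ∧ v.take i ∉ s).card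

theorem pathCount_zero_juxtapose (j : Fin n) (v : List (Fin n × ℕ))
    (a : Finset (List (Fin n × ℕ))) (b : Finset (ℕ × List (Fin n × ℕ))) :
    pathCount j (0, v) (juxtapose a b) = treePathCount j v a := by
  simp [pathCount, treePathCount]

theorem pathCount_succ_juxtapose (j : Fin n) (m : ℕ) (v : List (Fin n × ℕ))
    (a : Finset (List (Fin n × ℕ))) (b : Finset (ℕ × List (Fin n × ℕ))) :
    pathCount j (m + 1, v) (juxtapose a b) = pathCount j (m, v) b := by
  simp [pathCount]

/-- The first edge of the path has colour `i` and starts at the root, which is not in `graft b`.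
Once the root is added to the set, this edge no longer counts. -/
theorem treePathCount_graft (j i : Fin n) (m : ℕ) (v : List (Fin n × ℕ))
    (b : Fin n → Finset (ℕ × List (Fin n × ℕ))) :
    treePathCount j ((i, m) :: v) (graft b) =
      (if i = j then 1 else 0) + pathCount j (m, v) (b i) := by
  simp only [treePathCount, pathCount, List.length_cons, Fin.card_filter_univ_succ]
  split_ifs <;> simp_all [add_comm]

theorem treePathCount_insert_graft (j i : Fin n) (m : ℕ) (v : List (Fin n × ℕ))
    (b : Fin n → Finset (ℕ × List (Fin n × ℕ))) :
    treePathCount j ((i, m) :: v) (insert [] (graft b)) = pathCount j (m, v) (b i) := by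
  simp [treePathCount, pathCount, Fin.card_filter_univ_succ]

variable {k : Type*} [Field k]

/-- The factor of the weight of a set `s` of vertices of a forest that comes from the vertices
in `s`. -/
def halfWeight (q : Fin n → k) (s : Finset (ℕ × List (Fin n × ℕ))) : k :=
  ∏ v ∈ s, ∏ j, q j ^ pathCount j v s

/-- The analogue of `halfWeight` for a set of vertices of a tree. -/
def treeHalfWeight (q : Fin n → k) (s : Finset (List (Fin n × ℕ))) : k :=
  ∏ v ∈ s, ∏ j, q j ^ treePathCount j v s

/-- Each factor depends on one set of vertices only, so a single recursion for `halfWeight` serves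
both `s` and its complement. -/
theorem weight_eq (q₁ q₂ : Fin n → k) (u : List (PlanarTree n))
    (s : Finset (ℕ × List (Fin n × ℕ))) :
    weight q₁ q₂ u s = halfWeight q₁ s * halfWeight q₂ (forestVertices u \ s) := by
  rw [weight, Finset.prod_mul_distrib, halfWeight, halfWeight, Finset.prod_comm,
    Finset.prod_comm (s := Finset.univ)]

theorem halfWeight_juxtapose (q : Fin n → k) (a : Finset (List (Fin n × ℕ)))
    (b : Finset (ℕ × List (Fin n × ℕ))) :
    halfWeight q (juxtapose a b) = treeHalfWeight q a * halfWeight q b := by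
  simp [halfWeight, treeHalfWeight, prod_juxtapose, pathCount_zero_juxtapose,
    pathCount_succ_juxtapose]

/-- The edge from the missing root contributes one factor `q i` for each vertex of `b i`; these
powers will match the scalars in `sigma_mono`. -/
theorem treeHalfWeight_graft (q : Fin n → k) (b : Fin n → Finset (ℕ × List (Fin n × ℕ))) :
    treeHalfWeight q (graft b) = ∏ i, (q i ^ (b i).card * halfWeight q (b i)) := by
  have (i : Fin n) (v : ℕ × List (Fin n × ℕ)) :
      ∏ j, q j ^ treePathCount j ((i, v.1) :: v.2) (graft b) =
        q i * ∏ j, q j ^ pathCount j v (b i) := by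
    simp_rw [treePathCount_graft, pow_add, Finset.prod_mul_distrib, Finset.prod_pow_boole]
    simp
  simp [halfWeight, treeHalfWeight, prod_graft, this, Finset.prod_mul_distrib]

theorem treeHalfWeight_insert_graft (q : Fin n → k)
    (b : Fin n → Finset (ℕ × List (Fin n × ℕ))) :
    treeHalfWeight q (insert [] (graft b)) = ∏ i, halfWeight q (b i) := by
  rw [treeHalfWeight, Finset.prod_insert (nil_notMem_graft b), prod_graft]
  simp [halfWeight, treePathCount_insert_graft]
  -- What remains concerns the root, whose path has no edges.
  simp [treePathCount]

end Subsets

-- The coproduct as a sum over sets of vertices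

section Coproduct

variable {k : Type*} [Field k] {n : ℕ}

theorem mono_append (u u' : List (PlanarTree n)) :
    mono (k := k) (u ++ u') = mono u * mono u' := by
  simp [mono]

theorem mono_flatten (L : List (List (PlanarTree n))) :
    mono (k := k) L.flatten = (L.map mono).prod := by
  induction L with
  | nil => simp [mono]
  | cons u L ih => simp [mono_append, ih]

theorem mono_singleton (t : PlanarTree n) : mono (k := k) [t] = FreeAlgebra.ι k t := by
  simp [mono]

theorem prod_ofFn_smul : ∀ {m : ℕ} (c : Fin m → k) (x : Fin m → FreeAlgebra k (PlanarTree n)),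
    (List.ofFn fun i => c i • x i).prod = (∏ i, c i) • (List.ofFn x).prod
  | 0, _, _ => by simp
  | m + 1, c, x => by
    rw [List.ofFn_succ, List.ofFn_succ, List.prod_cons, List.prod_cons, prod_ofFn_smul,
      Fin.prod_univ_succ, smul_mul_smul_comm]

theorem sigma_mono (q : Fin n → k) (u : Fin n → List (PlanarTree n)) :
    sigma q (PiTensorProduct.tprod k fun i => mono (u i)) =
      (∏ i, q i ^ forestSize (u i)) • mono (List.ofFn u).flatten := by
  rw [sigma_tprod, mono_flatten, List.map_ofFn]
  simp only [scale_mono, prod_ofFn_smul]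
  rfl

/-- The first term is the case in which the new root goes to the complement, the second the case in
which it goes to `s`. -/
theorem pairOp_mono (q₁ q₂ : Fin n → k) (u u' : Fin n → List (PlanarTree n)) :
    pairOp q₁ q₂ (PiTensorProduct.tprod k fun i => mono (u i) ⊗ₜ mono (u' i)) =
      (∏ i, q₁ i ^ forestSize (u i)) • (mono (List.ofFn u).flatten ⊗ₜ mono [node u']) +
      (∏ i, q₂ i ^ forestSize (u' i)) • (mono [node u] ⊗ₜ mono (List.ofFn u').flatten) := by
  rw [pairOp_tmul, sigma_mono, sigma_mono, lam_mono, lam_mono, mono_singleton, mono_singleton,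
    TensorProduct.smul_tmul', TensorProduct.tmul_smul]

mutual
/-- The coproduct of a tree is a sum over its sets of vertices. -/
theorem treeComul_eq (q₁ q₂ : Fin n → k) : ∀ t : PlanarTree n,
    treeComul q₁ q₂ t = ∑ s ∈ (vertices t).powerset,
      (treeHalfWeight q₁ s * treeHalfWeight q₂ (vertices t \ s)) •
        (mono (treeInduced t (s : Set (List (Fin n × ℕ)))) ⊗ₜ[k]
          mono (treeInduced t ((vertices t \ s : Finset _) : Set (List (Fin n × ℕ)))))
  | node f => by
    have ih := fun i => forestComul_eq q₁ q₂ (f i)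
    simp only [treeComul, ih]
    -- The powerset is split by whether `s` contains the root. Both halves are indexed by the
    -- families `b`, and for each `b` the two summands together are one value of `pairOp`.
    rw [MultilinearMap.map_sum_finset, map_sum, vertices_node,
      Finset.sum_powerset_insert (nil_notMem_graft _), sum_powerset_graft, sum_powerset_graft,
      ← Finset.sum_add_distrib]
    refine Finset.sum_congr rfl fun b hb => ?_
    have hb : ∀ i, b i ⊆ forestVertices (f i) := by simpa using hb
    rw [MultilinearMap.map_smul_univ, map_smul, pairOp_mono, insert_graft_sdiff_graft,
      insert_graft_sdiff_insert_graft, treeInduced_graft, treeInduced_graft,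
      treeInduced_insert_graft, treeInduced_insert_graft, treeHalfWeight_graft,
      treeHalfWeight_graft, treeHalfWeight_insert_graft, treeHalfWeight_insert_graft, smul_add,
      smul_smul, smul_smul]
    simp only [fun i => forestSize_induced (f i) (b i) (hb i),
      fun i => forestSize_induced (f i) (forestVertices (f i) \ b i) Finset.sdiff_subset,
      ← Finset.prod_mul_distrib]
    congr 2 <;> exact Finset.prod_congr rfl fun i _ => by ring
/-- The coproduct of an ordered forest is a sum over its sets of vertices. -/
theorem forestComul_eq (q₁ q₂ : Fin n → k) : ∀ u : List (PlanarTree n),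
    forestComul q₁ q₂ u = ∑ s ∈ (forestVertices u).powerset,
      (halfWeight q₁ s * halfWeight q₂ (forestVertices u \ s)) •
        (mono (induced u (s : Set (ℕ × List (Fin n × ℕ)))) ⊗ₜ[k]
          mono (induced u ((forestVertices u \ s : Finset _) : Set (ℕ × List (Fin n × ℕ)))))
  | [] => by
    simp [forestComul, forestVertices, induced, halfWeight, mono, Algebra.TensorProduct.one_def]
  | t :: u => by
    rw [forestComul, treeComul_eq q₁ q₂ t, forestComul_eq q₁ q₂ u, forestVertices_cons,
      sum_powerset_juxtapose, Finset.sum_mul]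
    refine Finset.sum_congr rfl fun a _ => ?_
    rw [Finset.mul_sum]
    refine Finset.sum_congr rfl fun b _ => ?_
    rw [juxtapose_sdiff, induced_juxtapose, induced_juxtapose, halfWeight_juxtapose,
      halfWeight_juxtapose, mono_append, mono_append, smul_mul_smul_comm,
      Algebra.TensorProduct.tmul_mul_tmul, mul_mul_mul_comm]
end

theorem comulHom_mono_eq_sum (q₁ q₂ : Fin n → k) (u : List (PlanarTree n)) :
    comulHom q₁ q₂ (mono u) = ∑ s ∈ (forestVertices u).powerset, weight q₁ q₂ u s •
      (mono (induced u (s : Set (ℕ × List (Fin n × ℕ)))) ⊗ₜ[k]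
        mono (induced u ((forestVertices u \ s : Finset (ℕ × List (Fin n × ℕ))) :
          Set (ℕ × List (Fin n × ℕ))))) := by
  simp only [comulHom_mono, forestComul_eq, weight_eq]

end Coproduct

-- The graded dual and its primitive elements

section Dual

variable {k : Type*} [Field k] {n : ℕ}

theorem one_le_size : ∀ t : PlanarTree n, 1 ≤ size t
  | node f => by simp [size]

/-- A tree with at most `N + 1` vertices is given by `n` forests with at most `N` vertices. A
nonempty forest with at most `N + 1` vertices is such a tree followed by a forest with at most `N`
vertices. -/
theorem finite_forestSize_le : ∀ N : ℕ, {u : List (PlanarTree n) | forestSize u ≤ N}.Finite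
  | 0 => by
    refine (Set.finite_singleton []).subset fun u hu => ?_
    cases u with
    | nil => rfl
    | cons t u =>
      have := one_le_size t
      simp only [Set.mem_ofPred_eq, forestSize] at hu
      omega
  | N + 1 => by
    have ih := finite_forestSize_le N
    have hT : {t : PlanarTree n | size t ≤ N + 1}.Finite := by
      refine ((Set.Finite.pi fun _ : Fin n => ih).image node).subset ?_
      rintro ⟨f⟩ hf
      refine ⟨f, fun i _ => ?_, rfl⟩
      simp only [Set.mem_ofPred_eq, size] at hf ⊢
      have := Finset.single_le_sum (f := fun i => forestSize (f i)) (fun _ _ => Nat.zero_le _)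
        (Finset.mem_univ i)
      omega
    refine ((hT.image2 List.cons ih).insert []).subset fun u hu => ?_
    cases u with
    | nil => exact Or.inl rfl
    | cons t u =>
      have := one_le_size t
      simp only [Set.mem_ofPred_eq, forestSize] at hu
      refine Or.inr ⟨t, ?_, u, ?_, rfl⟩ <;> simp only [Set.mem_ofPred_eq] <;> omega

theorem finite_size_le (N : ℕ) : {t : PlanarTree n | size t ≤ N}.Finite := by
  refine ((finite_forestSize_le N).preimage (List.singleton_injective.injOn)).subset fun t ht => ?_
  simpa [forestSize] using ht

theorem linearMap_ext_mono {M : Type*} [AddCommGroup M] [Module k M]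
    {F G : FreeAlgebra k (PlanarTree n) →ₗ[k] M} (h : ∀ u, F (mono u) = G (mono u)) : F = G :=
  (forestBasis k n).ext fun u => by simpa [forestBasis_apply] using h u.toList

theorem dualTree_mono [DecidableEq (PlanarTree n)] (t : PlanarTree n) (u : List (PlanarTree n)) :
    dualTree k t (mono u) = if u = [t] then 1 else 0 := by
  have h : mono u = forestBasis k n (FreeMonoid.ofList u) := by simp [forestBasis_apply]
  rw [dualTree, h, Basis.coord_apply, Basis.repr_self]
  split_ifs with hu
  · subst hu
    exact Finsupp.single_eq_same
  · exact Finsupp.single_eq_of_ne' fun h => hu (FreeMonoid.ofList.injective h)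

theorem counitHom_mono (u : List (PlanarTree n)) :
    counitHom (k := k) (mono u) = if u = [] then 1 else 0 := by
  cases u <;> simp [mono, counitHom]

/-- Evaluation on pure tensors turns primitivity into the derivation rule along the counit. -/
theorem mem_dualPrimitives_iff_mul {φ : Dual k (FreeAlgebra k (PlanarTree n))} :
    φ ∈ dualPrimitives k n ↔ φ ∈ gradedDual k n ∧
      ∀ x y, φ (x * y) = φ x * counitHom y + counitHom x * φ y := by
  rw [mem_dualPrimitives]
  refine and_congr_right fun _ => ⟨fun h x y => ?_, fun h => TensorProduct.ext' fun x y => ?_⟩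
  · simpa using congrArg (fun F => F (x ⊗ₜ y)) h
  · simpa using h x y

/-- The primitive elements are the elements of the graded dual that vanish on all ordered forests
other than single trees. -/
theorem mem_dualPrimitives_iff_mono {φ : Dual k (FreeAlgebra k (PlanarTree n))} :
    φ ∈ dualPrimitives k n ↔ φ ∈ gradedDual k n ∧
      ∀ u : List (PlanarTree n), u.length ≠ 1 → φ (mono u) = 0 := by
  rw [mem_dualPrimitives_iff_mul]
  refine and_congr_right fun _ => ⟨fun h u hu => ?_, fun h => ?_⟩
  · match u with
    -- The rule at `1 * 1` reads `φ 1 = φ 1 + φ 1`.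
    | [] => simpa [mono] using h 1 1
    | [t] => simp at hu
    | t :: t' :: u =>
      rw [← List.singleton_append, mono_append, h, counitHom_mono, counitHom_mono]
      simp
  · have h1 : φ 1 = 0 := by simpa [mono] using h [] (by simp)
    -- As an equation of bilinear maps, the rule need only be tested on pairs of forests.
    suffices H : (LinearMap.mul k (FreeAlgebra k (PlanarTree n))).compr₂ φ =
        (LinearMap.mul k k).compl₁₂ φ counitHom.toLinearMap +
          (LinearMap.mul k k).compl₁₂ counitHom.toLinearMap φ by
      intro x y
      simpa using congrArg (fun F => F x y) H
    refine linearMap_ext_mono fun u => linearMap_ext_mono fun u' => ?_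
    simp only [LinearMap.compr₂_apply, LinearMap.mul_apply', LinearMap.add_apply,
      LinearMap.compl₁₂_apply, AlgHom.toLinearMap_apply]
    cases u with
    | nil => simp [mono, h1]
    | cons t u =>
      cases u' with
      | nil => simp [mono, h1]
      | cons t' u' =>
        rw [← mono_append, h _ (by simp), counitHom_mono, counitHom_mono]
        simp

theorem dualTree_mem_dualPrimitives (t : PlanarTree n) : dualTree k t ∈ dualPrimitives k n := by
  classical
  refine mem_dualPrimitives_iff_mono.2 ⟨⟨size t + 1, fun u hu => ?_⟩, fun u hu => ?_⟩
  · rw [dualTree_mono, if_neg]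
    rintro rfl
    simp [forestSize] at hu
  · rw [dualTree_mono, if_neg]
    rintro rfl
    simp at hu

theorem dualPrimitives_eq_span : dualPrimitives k n =
    Submodule.span k (Set.range fun t : PlanarTree n => dualTree k t) := by
  classical
  refine le_antisymm (fun φ hφ => ?_) ?_
  · obtain ⟨⟨N, hN⟩, h⟩ := mem_dualPrimitives_iff_mono.1 hφ
    -- `φ` vanishes from degree `N` on, so the trees of size exactly `N` enter with coefficient
    -- zero.
    have : φ = ∑ t ∈ (finite_size_le (n := n) N).toFinset, φ (mono [t]) • dualTree k t := by
      refine linearMap_ext_mono fun u => ?_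
      simp only [LinearMap.sum_apply, LinearMap.smul_apply, dualTree_mono, smul_eq_mul]
      by_cases hu : u.length = 1
      · obtain ⟨w, rfl⟩ := List.length_eq_one_iff.1 hu
        simp only [List.cons.injEq, and_true, mul_ite, mul_one, mul_zero, Finset.sum_ite_eq]
        split_ifs with hw
        · rfl
        · refine hN _ ?_
          simp only [Set.Finite.mem_toFinset, Set.mem_ofPred_eq] at hw
          simp only [forestSize]
          omega
      · rw [h u hu, Finset.sum_eq_zero]
        intro t _
        rw [if_neg, mul_zero]
        rintro rfl
        simp at hu
    rw [this]
    exact Submodule.sum_mem _ fun t _ =>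
      Submodule.smul_mem _ _ (Submodule.subset_span ⟨t, rfl⟩)
  · rw [Submodule.span_le]
    rintro _ ⟨t, rfl⟩
    exact dualTree_mem_dualPrimitives t

theorem linearIndependent_dualTree :
    LinearIndependent k fun t : PlanarTree n => dualTree k t := by
  classical
  refine linearIndependent_iff'.2 fun S g h w hw => ?_
  simpa [dualTree_mono, hw] using congrArg (fun F => F (mono [w])) h

/-! ### The convolution product -/

/-- The product `φ ψ = (φ ⊗ ψ) ∘ Δ` of the dual. -/
noncomputable def dualMul (q₁ q₂ : Fin n → k) :
    Dual k (FreeAlgebra k (PlanarTree n)) →ₗ[k] Dual k (FreeAlgebra k (PlanarTree n)) →ₗ[k]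
      Dual k (FreeAlgebra k (PlanarTree n)) :=
  (TensorProduct.mk k _ _).compr₂ (LinearMap.lcomp k k (comulHom q₁ q₂).toLinearMap ∘ₗ
    TensorProduct.dualDistrib k _ _)

theorem dualMul_apply (q₁ q₂ : Fin n → k) (φ ψ : Dual k (FreeAlgebra k (PlanarTree n)))
    (x : FreeAlgebra k (PlanarTree n)) :
    dualMul q₁ q₂ φ ψ x = TensorProduct.dualDistrib k _ _ (φ ⊗ₜ ψ) (comulHom q₁ q₂ x) :=
  rfl

/-- This links the convolution product of `WithConv`, which underlies `dualBracket`, with `dualMul`.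
-/
theorem mul'_map_eq_dualDistrib (φ ψ : Dual k (FreeAlgebra k (PlanarTree n)))
    (z : FreeAlgebra k (PlanarTree n) ⊗[k] FreeAlgebra k (PlanarTree n)) :
    LinearMap.mul' k k (TensorProduct.map φ ψ z) =
      TensorProduct.dualDistrib k _ _ (φ ⊗ₜ ψ) z := by
  induction z with
  | zero => simp
  | tmul x y => simp
  | add x y hx hy => rw [map_add, map_add, hx, hy, map_add]

theorem dualBracket_eq (q₁ q₂ : Fin n → k) (φ ψ : Dual k (FreeAlgebra k (PlanarTree n))) :
    dualBracket q₁ q₂ φ ψ = dualMul q₁ q₂ φ ψ - dualMul q₁ q₂ ψ φ := by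
  ext x
  rw [LinearMap.sub_apply, dualMul_apply, dualMul_apply, ← mul'_map_eq_dualDistrib,
    ← mul'_map_eq_dualDistrib]
  rfl

theorem dualMul_mono (q₁ q₂ : Fin n → k) (φ ψ : Dual k (FreeAlgebra k (PlanarTree n)))
    (u : List (PlanarTree n)) :
    dualMul q₁ q₂ φ ψ (mono u) = ∑ s ∈ (forestVertices u).powerset, weight q₁ q₂ u s *
      (φ (mono (induced u (s : Set (ℕ × List (Fin n × ℕ))))) *
        ψ (mono (induced u ((forestVertices u \ s : Finset (ℕ × List (Fin n × ℕ))) :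
          Set (ℕ × List (Fin n × ℕ)))))) := by
  simp [dualMul_apply, comulHom_mono_eq_sum]

theorem forestSize_induced_add (u : List (PlanarTree n)) {s : Finset (ℕ × List (Fin n × ℕ))}
    (hs : s ⊆ forestVertices u) :
    forestSize (induced u (s : Set (ℕ × List (Fin n × ℕ)))) +
      forestSize (induced u ((forestVertices u \ s : Finset (ℕ × List (Fin n × ℕ))) :
        Set (ℕ × List (Fin n × ℕ)))) = forestSize u := by
  rw [forestSize_induced u s hs, forestSize_induced u _ Finset.sdiff_subset,
    add_comm, Finset.card_sdiff_add_card_eq_card hs, card_forestVertices]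

/-- The sizes of `s` and its complement add up to that of `u`; if this is at least `N + M`, one of
the two forests is large enough to be annihilated. -/
theorem dualMul_mem_gradedDual (q₁ q₂ : Fin n → k) {φ ψ : Dual k (FreeAlgebra k (PlanarTree n))}
    (hφ : φ ∈ gradedDual k n) (hψ : ψ ∈ gradedDual k n) :
    dualMul q₁ q₂ φ ψ ∈ gradedDual k n := by
  obtain ⟨N, hN⟩ := hφ
  obtain ⟨M, hM⟩ := hψ
  refine ⟨N + M, fun u hu => ?_⟩
  rw [dualMul_mono]
  refine Finset.sum_eq_zero fun s hs => ?_
  have := forestSize_induced_add u (Finset.mem_powerset.1 hs)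
  rcases le_or_gt N (forestSize (induced u (s : Set (ℕ × List (Fin n × ℕ))))) with h | h
  · rw [hN _ h, zero_mul, mul_zero]
  · rw [hM _ (by omega), mul_zero, mul_zero]

/-- On pure tensors this is the product of the derivation rules for `φ` and `ψ`, multiplied out. -/
theorem dualDistrib_mul {φ ψ : Dual k (FreeAlgebra k (PlanarTree n))}
    (hφ : φ ∈ dualPrimitives k n) (hψ : ψ ∈ dualPrimitives k n)
    (X Y : FreeAlgebra k (PlanarTree n) ⊗[k] FreeAlgebra k (PlanarTree n)) :
    TensorProduct.dualDistrib k _ _ (φ ⊗ₜ ψ) (X * Y) =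
      TensorProduct.dualDistrib k _ _ (φ ⊗ₜ ψ) X *
        TensorProduct.dualDistrib k _ _ (counitHom.toLinearMap ⊗ₜ counitHom.toLinearMap) Y +
      TensorProduct.dualDistrib k _ _ (φ ⊗ₜ counitHom.toLinearMap) X *
        TensorProduct.dualDistrib k _ _ (counitHom.toLinearMap ⊗ₜ ψ) Y +
      TensorProduct.dualDistrib k _ _ (counitHom.toLinearMap ⊗ₜ ψ) X *
        TensorProduct.dualDistrib k _ _ (φ ⊗ₜ counitHom.toLinearMap) Y +
      TensorProduct.dualDistrib k _ _ (counitHom.toLinearMap ⊗ₜ counitHom.toLinearMap) X *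
        TensorProduct.dualDistrib k _ _ (φ ⊗ₜ ψ) Y := by
  have h1 := (mem_dualPrimitives_iff_mul.1 hφ).2
  have h2 := (mem_dualPrimitives_iff_mul.1 hψ).2
  induction X with
  | zero => simp
  | add X X' hX hX' => rw [add_mul, map_add, hX, hX']; simp only [map_add]; ring
  | tmul x x' =>
    induction Y with
    | zero => simp
    | add Y Y' hY hY' => rw [mul_add, map_add, hY, hY']; simp only [map_add]; ring
    | tmul y y' =>
      simp only [Algebra.TensorProduct.tmul_mul_tmul, TensorProduct.dualDistrib_apply, h1, h2,
        AlgHom.toLinearMap_apply]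
      ring

/-- The counit is the unit of the convolution algebra of the bialgebra. -/
theorem dualMul_counitHom (q₁ q₂ : Fin n → k) (φ : Dual k (FreeAlgebra k (PlanarTree n))) :
    dualMul q₁ q₂ φ counitHom.toLinearMap = φ := by
  let := bialgebra q₁ q₂
  ext x
  rw [dualMul_apply, ← mul'_map_eq_dualDistrib]
  exact congrArg (fun F => F.ofConv x) (mul_one (WithConv.toConv φ))

theorem counitHom_dualMul (q₁ q₂ : Fin n → k) (φ : Dual k (FreeAlgebra k (PlanarTree n))) :
    dualMul q₁ q₂ counitHom.toLinearMap φ = φ := by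
  let := bialgebra q₁ q₂
  ext x
  rw [dualMul_apply, ← mul'_map_eq_dualDistrib]
  exact congrArg (fun F => F.ofConv x) (one_mul (WithConv.toConv φ))

/-- Multiplicativity of `Δ` reduces this to `dualDistrib_mul`. The two middle terms are the
obstruction to primitivity and are symmetric in `φ` and `ψ`. -/
theorem dualMul_mul (q₁ q₂ : Fin n → k) {φ ψ : Dual k (FreeAlgebra k (PlanarTree n))}
    (hφ : φ ∈ dualPrimitives k n) (hψ : ψ ∈ dualPrimitives k n)
    (x y : FreeAlgebra k (PlanarTree n)) :
    dualMul q₁ q₂ φ ψ (x * y) = dualMul q₁ q₂ φ ψ x * counitHom y + φ x * ψ y + ψ x * φ y +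
      counitHom x * dualMul q₁ q₂ φ ψ y := by
  rw [dualMul_apply, map_mul, dualDistrib_mul hφ hψ]
  simp only [← dualMul_apply, dualMul_counitHom, counitHom_dualMul, AlgHom.toLinearMap_apply]

/-- The primitive elements are closed under the commutator. -/
theorem dualBracket_mem_dualPrimitives (q₁ q₂ : Fin n → k)
    {φ ψ : Dual k (FreeAlgebra k (PlanarTree n))}
    (hφ : φ ∈ dualPrimitives k n) (hψ : ψ ∈ dualPrimitives k n) :
    dualBracket q₁ q₂ φ ψ ∈ dualPrimitives k n := by
  rw [dualBracket_eq]
  refine mem_dualPrimitives_iff_mul.2 ⟨Submodule.sub_mem _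
    (dualMul_mem_gradedDual q₁ q₂ hφ.1 hψ.1) (dualMul_mem_gradedDual q₁ q₂ hψ.1 hφ.1),
    fun x y => ?_⟩
  simp only [LinearMap.sub_apply, dualMul_mul q₁ q₂ hφ hψ, dualMul_mul q₁ q₂ hψ hφ]
  ring

/-! ### The product on the primitive elements -/

/-- The projection of the free algebra onto the span of the trees that annihilates all other
ordered forests. -/
noncomputable def treePart :
    FreeAlgebra k (PlanarTree n) →ₗ[k] FreeAlgebra k (PlanarTree n) :=
  (forestBasis k n).constr k fun u => if u.toList.length = 1 then mono u.toList else 0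

theorem treePart_mono (u : List (PlanarTree n)) :
    treePart (mono (k := k) u) = if u.length = 1 then mono u else 0 := by
  have h : mono u = forestBasis k n (FreeMonoid.ofList u) := by simp [forestBasis_apply]
  rw [treePart, h, Basis.constr_basis, ← h]
  rfl

/-- With the next lemma: the transpose of `treePart` projects the graded dual onto the primitive
elements. -/
theorem comp_treePart_mem_dualPrimitives {φ : Dual k (FreeAlgebra k (PlanarTree n))}
    (hφ : φ ∈ gradedDual k n) : φ ∘ₗ treePart ∈ dualPrimitives k n := by
  obtain ⟨N, hN⟩ := hφ
  refine mem_dualPrimitives_iff_mono.2 ⟨⟨N, fun u hu => ?_⟩, fun u hu => ?_⟩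
  · rw [LinearMap.comp_apply, treePart_mono]
    split_ifs
    · exact hN u hu
    · exact map_zero φ
  · rw [LinearMap.comp_apply, treePart_mono, if_neg hu, map_zero]

theorem comp_treePart_of_mem_dualPrimitives {φ : Dual k (FreeAlgebra k (PlanarTree n))}
    (hφ : φ ∈ dualPrimitives k n) : φ ∘ₗ treePart = φ := by
  refine linearMap_ext_mono fun u => ?_
  rw [LinearMap.comp_apply, treePart_mono]
  split_ifs with hu
  · rfl
  · rw [map_zero, (mem_dualPrimitives_iff_mono.1 hφ).2 u hu]

/-- The product `•` on the primitive elements: the part of the convolution product that is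
supported on single trees. -/
noncomputable def insertion (q₁ q₂ : Fin n → k) :
    dualPrimitives k n →ₗ[k] dualPrimitives k n →ₗ[k] dualPrimitives k n :=
  LinearMap.mk₂ k (fun φ ψ => ⟨dualMul q₁ q₂ φ ψ ∘ₗ treePart,
      comp_treePart_mem_dualPrimitives (dualMul_mem_gradedDual q₁ q₂ φ.2.1 ψ.2.1)⟩)
    (fun _ _ _ => Subtype.ext (by simp [LinearMap.add_comp]))
    (fun _ _ _ => Subtype.ext (by simp [LinearMap.smul_comp]))
    (fun _ _ _ => Subtype.ext (by simp [LinearMap.add_comp]))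
    (fun _ _ _ => Subtype.ext (by simp [LinearMap.smul_comp]))

theorem coe_insertion (q₁ q₂ : Fin n → k) (φ ψ : dualPrimitives k n) :
    (insertion q₁ q₂ φ ψ : Dual k (FreeAlgebra k (PlanarTree n))) =
      dualMul q₁ q₂ φ ψ ∘ₗ treePart :=
  rfl

/-- The bracket is primitive, hence unchanged by the projection, which is linear and carries the two
convolution products to the two values of `•`. -/
theorem dualBracket_eq_insertion (q₁ q₂ : Fin n → k) (φ ψ : dualPrimitives k n) :
    dualBracket q₁ q₂ φ ψ = ((insertion q₁ q₂ φ ψ - insertion q₁ q₂ ψ φ :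
      dualPrimitives k n) : Dual k (FreeAlgebra k (PlanarTree n))) := by
  rw [← comp_treePart_of_mem_dualPrimitives (dualBracket_mem_dualPrimitives q₁ q₂ φ.2 ψ.2),
    dualBracket_eq, Submodule.coe_sub, coe_insertion, coe_insertion, LinearMap.sub_comp]

/-- A nonzero coefficient forces `size w = size s + size t`. -/
theorem finite_insertionCoeff_ne_zero (q₁ q₂ : Fin n → k) (s t : PlanarTree n) :
    {w | insertionCoeff q₁ q₂ s t w ≠ 0}.Finite := by
  refine (finite_size_le (size s + size t)).subset fun w hw => ?_
  obtain ⟨S, hS, -⟩ := Finset.exists_ne_zero_of_sum_ne_zero hw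
  simp only [Finset.mem_filter, Finset.mem_powerset] at hS
  have := forestSize_induced_add [w] hS.1
  rw [hS.2.1, hS.2.2] at this
  simp only [forestSize, add_zero] at this
  exact this.ge

theorem dualMul_dualTree_mono_singleton (q₁ q₂ : Fin n → k) (s t w : PlanarTree n) :
    dualMul q₁ q₂ (dualTree k s) (dualTree k t) (mono [w]) = insertionCoeff q₁ q₂ s t w := by
  classical
  rw [dualMul_mono, insertionCoeff, Finset.sum_filter]
  refine Finset.sum_congr (by congr) fun S _ => ?_
  rw [dualTree_mono, dualTree_mono]
  split_ifs <;> simp_all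

theorem insertion_dualTree (q₁ q₂ : Fin n → k) (s t : PlanarTree n)
    (hs : dualTree k s ∈ dualPrimitives k n) (ht : dualTree k t ∈ dualPrimitives k n) :
    (insertion q₁ q₂ ⟨_, hs⟩ ⟨_, ht⟩ : Dual k (FreeAlgebra k (PlanarTree n))) =
      ∑ᶠ w, insertionCoeff q₁ q₂ s t w • dualTree k w := by
  classical
  have hfin := finite_insertionCoeff_ne_zero q₁ q₂ s t
  -- Finite support makes `∑ᶠ` a genuine sum rather than its default value `0`.
  rw [finsum_eq_sum_of_support_subset (s := hfin.toFinset) _ fun w hw => by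
    simpa using left_ne_zero_of_smul hw]
  refine linearMap_ext_mono fun u => ?_
  rw [coe_insertion, LinearMap.comp_apply, treePart_mono]
  simp only [LinearMap.sum_apply, LinearMap.smul_apply, dualTree_mono, smul_eq_mul]
  split_ifs with hu
  · obtain ⟨w, rfl⟩ := List.length_eq_one_iff.1 hu
    rw [dualMul_dualTree_mono_singleton]
    -- Only the term of `w` survives; if `w` is not in the index set, its coefficient is zero
    -- anyway.
    simp +contextual [eq_comm]
  · rw [map_zero, Finset.sum_eq_zero]
    intro w _
    rw [if_neg, mul_zero]
    rintro rfl
    simp at hu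

end Dual

end PlanarTree

theorem mainTheorem9 {k : Type*} [Field k] [CharZero k] {n : ℕ} (q₁ q₂ : Fin n → k) :
    (∀ u : List (PlanarTree n),
      PlanarTree.comulHom q₁ q₂ (PlanarTree.mono u) =
        ∑ s ∈ (PlanarTree.forestVertices u).powerset,
          PlanarTree.weight q₁ q₂ u s •
            (PlanarTree.mono (PlanarTree.induced u (s : Set (ℕ × List (Fin n × ℕ)))) ⊗ₜ[k]
              PlanarTree.mono (PlanarTree.induced u
                ((PlanarTree.forestVertices u \ s : Finset (ℕ × List (Fin n × ℕ))) :
                  Set (ℕ × List (Fin n × ℕ)))))) ∧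
    PlanarTree.dualPrimitives k n =
      Submodule.span k (Set.range fun t : PlanarTree n => PlanarTree.dualTree k t) ∧
    LinearIndependent k (fun t : PlanarTree n => PlanarTree.dualTree k t) ∧
    (∀ s t : PlanarTree n, {w | PlanarTree.insertionCoeff q₁ q₂ s t w ≠ 0}.Finite) ∧
    ∃ bullet : PlanarTree.dualPrimitives k n →ₗ[k] PlanarTree.dualPrimitives k n →ₗ[k]
        PlanarTree.dualPrimitives k n,
      (∀ (s t : PlanarTree n) (hs : PlanarTree.dualTree k s ∈ PlanarTree.dualPrimitives k n)
        (ht : PlanarTree.dualTree k t ∈ PlanarTree.dualPrimitives k n),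
        (bullet ⟨_, hs⟩ ⟨_, ht⟩ : Module.Dual k (FreeAlgebra k (PlanarTree n))) =
          ∑ᶠ w, PlanarTree.insertionCoeff q₁ q₂ s t w • PlanarTree.dualTree k w) ∧
      ∀ φ ψ : PlanarTree.dualPrimitives k n,
        PlanarTree.dualBracket q₁ q₂ φ ψ = ((bullet φ ψ - bullet ψ φ :
          PlanarTree.dualPrimitives k n) : Module.Dual k (FreeAlgebra k (PlanarTree n))) :=
  ⟨PlanarTree.comulHom_mono_eq_sum q₁ q₂, PlanarTree.dualPrimitives_eq_span,
    PlanarTree.linearIndependent_dualTree, PlanarTree.finite_insertionCoeff_ne_zero q₁ q₂,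
    PlanarTree.insertion q₁ q₂, PlanarTree.insertion_dualTree q₁ q₂,
    PlanarTree.dualBracket_eq_insertion q₁ q₂⟩
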